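/- Fix $0<\alpha<1$. An interval partition is a set $\beta$ of disjoint nonempty open subintervals of some interval $[0,L]$, $0\le L<\infty$, that cover $[0,L]$ up to a Lebesgue-null set; write $\|\beta\|:=L$. Let $\mathcal I_\alpha$ be the set of interval partitions $\beta$ for which the limit $$\mathscr D_\beta(t):=\Gamma(1-\alpha)\lim_{h\downarrow 0}h^\alpha\,\#\{(a,b)\in\beta\colon |b-a|>h,\ b\le t\}$$ exists in $[0,\infty)$ for every $t\in[0,\|\beta\|]$. Write $\mathscr D_\beta(\infty):=\mathscr D_\beta(\|\beta\|)$ and, for $U\in\beta$, write $\mathscr D_\beta(U)$ for the constant value of $\mathscr D_\beta$ on $U$. For $\beta,\gamma\in\mathcal I_\alpha$ let $$d_\alpha(\beta,\gamma):=\inf\ \mathrm{dis}_\alpha\big(\beta,\gamma,(U_j,V_j)_{1\le j\le n}\big),$$ where the infimum is over all $n\ge 0$ and all finite sequences $(U_1,V_1),\ldots,(U_n,V_n)$ in $\beta\times\gamma$ such that $(U_j)$ and $(V_j)$ are both strictly increasing from left to right, and $\mathrm{dis}_\alpha$ is the maximum of the four quantities $$\sum_{j}|\mathrm{Leb}(U_j)-\mathrm{Leb}(V_j)|+\|\beta\|-\sum_{j}\mathrm{Leb}(U_j),\qquad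 \sum_{j}|\mathrm{Leb}(U_j)-\mathrm{Leb}(V_j)|+\|\gamma\|-\sum_{j}\mathrm{Leb}(V_j),$$ $$\sup_{j}|\mathscr D_\beta(U_j)-\mathscr D_\gamma(V_j)|,\qquad |\mathscr D_\beta(\infty)-\mathscr D_\gamma(\infty)|$$ (with the supremum of the empty set equal to $0$). Let $\mathbb T$ be the space of root- and measure-preserving isometry classes of compact rooted $\mathbb R$-trees equipped with a finite Borel measure, with the Gromov–Hausdorff–Prokhorov metric: the distance of $(X,\rho,\mu)$ and $(Y,\sigma,\nu)$ is the infimum, over all isometric embeddings $\varphi\colon X\to Z$, $\psi\colon Y\to Z$ into a common metric space $Z$, of the maximum of the distance between $\varphi(\rho)$ and $\psi(\sigma)$, the Hausdorff distance between $\varphi(X)$ and $\psi(Y)$, and the (two-sided) Prokhorov distance between the image measures $\varphi_*\mu$ and $\psi_*\nu$. Then the map $T\colon\mathcal I_\alpha\to\mathbb T$ that sends $\beta$ to the isometry class of the interval $[0,\mathscr D_\beta(\infty)]$ with the Euclidean metric, the root $0$ and the measure $M(\beta)=\sum_{U\in\beta}\mathrm{Leb}(U)\,\delta_{\mathscr D_\beta(U)}$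 is continuous from $(\mathcal I_\alpha,d_\alpha)$ to $\mathbb T$. -/

import Mathlib

open MeasureTheory Set Filter Topology
open scoped ENNReal

noncomputable section

/-! ## Interval partitions and diversity -/

/-- An interval partition of `[0, mass]`: a set of disjoint nonempty open intervals `(a, b)`,
encoded by their endpoints `(a, b)`, contained in `[0, mass]` and covering it up to a Lebesgue-null
set. (The number `mass` is determined by the blocks: it is the sum of their lengths.) -/
structure IntervalPartition where
  mass : ℝ
  mass_nonneg : 0 ≤ mass
  blocks : Set (ℝ × ℝ)
  nonneg_left : ∀ U ∈ blocks, 0 ≤ U.1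
  left_lt_right : ∀ U ∈ blocks, U.1 < U.2
  right_le : ∀ U ∈ blocks, U.2 ≤ mass
  disjoint : blocks.PairwiseDisjoint (fun U => Ioo U.1 U.2)
  null_compl : volume (Icc 0 mass \ ⋃ U ∈ blocks, Ioo U.1 U.2) = 0

/-- The length (Lebesgue measure) of the interval with endpoints `U`. -/
def leb (U : ℝ × ℝ) : ℝ := U.2 - U.1

namespace IntervalPartition

/-- The blocks longer than `h` which lie to the left of `t`. -/
def longBlocks (β : IntervalPartition) (h t : ℝ) : Set (ℝ × ℝ) :=
  {U ∈ β.blocks | h < |U.2 - U.1| ∧ U.2 ≤ t}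

/-- `h ^ α * #{(a, b) ∈ β : |b - a| > h, b ≤ t}`. -/
def scaledCount (α : ℝ) (β : IntervalPartition) (t h : ℝ) : ℝ :=
  h ^ α * ((β.longBlocks h t).ncard : ℝ)

/-- The `α`-diversity property: the (finite) limit defining the diversity exists for every
`t ∈ [0, mass]`. -/
def HasDiversity (α : ℝ) (β : IntervalPartition) : Prop :=
  ∀ t ∈ Icc 0 β.mass, ∃ x : ℝ, Tendsto (scaledCount α β t) (𝓝[>] 0) (𝓝 x)

/-- The diversity of `β` up to `t`. -/
def diversity (α : ℝ) (β : IntervalPartition) (t : ℝ) : ℝ :=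
  Real.Gamma (1 - α) * limUnder (𝓝[>] 0) (scaledCount α β t)

/-- The diversity up to a block `U`: the value of the diversity at a point of `U`, here the
midpoint. It does not depend on the point, see `diversity_eq_blockDiversity`. -/
def blockDiversity (α : ℝ) (β : IntervalPartition) (U : ℝ × ℝ) : ℝ :=
  β.diversity α ((U.1 + U.2) / 2)

/-- The total diversity. -/
def totalDiversity (α : ℝ) (β : IntervalPartition) : ℝ := β.diversity α β.mass

theorem right_le_left_of_mem (β : IntervalPartition) {U V : ℝ × ℝ} (hU : U ∈ β.blocks)
    (hV : V ∈ β.blocks) {t : ℝ} (ht : t ∈ Ioo U.1 U.2) (hVt : V.2 ≤ t) : V.2 ≤ U.1 := by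
  by_contra! hlt
  have hne : V ≠ U := by
    rintro rfl
    exact absurd ht.2 (not_lt.mpr hVt)
  have hd := β.disjoint hV hU hne
  have hV' := β.left_lt_right V hV
  obtain ⟨s, hs1, hs2⟩ := exists_between (max_lt hV' hlt)
  have hsV : s ∈ Ioo V.1 V.2 := ⟨lt_of_le_of_lt (le_max_left _ _) hs1, hs2⟩
  have hsU : s ∈ Ioo U.1 U.2 := ⟨lt_of_le_of_lt (le_max_right _ _) hs1, by linarith [ht.2]⟩
  exact Set.disjoint_left.mp hd hsV hsU

/-- The diversity is constant on every block. -/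
theorem diversity_eq_blockDiversity (α : ℝ) (β : IntervalPartition) {U : ℝ × ℝ}
    (hU : U ∈ β.blocks) {t : ℝ} (ht : t ∈ Ioo U.1 U.2) :
    β.diversity α t = β.blockDiversity α U := by
  have hlt := β.left_lt_right U hU
  have key : ∀ s ∈ Ioo U.1 U.2, scaledCount α β s = scaledCount α β U.1 := by
    intro s hs
    funext h
    have : β.longBlocks h s = β.longBlocks h U.1 := by
      ext V
      constructor
      · rintro ⟨hV, h1, h2⟩
        exact ⟨hV, h1, β.right_le_left_of_mem hU hV hs h2⟩
      · rintro ⟨hV, h1, h2⟩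
        exact ⟨hV, h1, h2.trans hs.1.le⟩
    simp only [scaledCount, this]
  have hmid : (U.1 + U.2) / 2 ∈ Ioo U.1 U.2 := ⟨by linarith, by linarith⟩
  simp only [blockDiversity, diversity, key t ht, key _ hmid]

theorem tsum_leb_le (β : IntervalPartition) :
    ∑' U : β.blocks, ENNReal.ofReal (leb U.1) ≤ ENNReal.ofReal β.mass := by
  have h1 : ∑' U : β.blocks, volume (Ioo U.1.1 U.1.2) ≤
      volume (⋃ U : β.blocks, Ioo U.1.1 U.1.2) :=
    tsum_meas_le_meas_iUnion_of_disjoint _ (fun U => measurableSet_Ioo)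
      (fun U V hUV => β.disjoint U.2 V.2 (fun h => hUV (Subtype.ext h)))
  have h2 : volume (⋃ U : β.blocks, Ioo U.1.1 U.1.2) ≤ volume (Icc 0 β.mass) := by
    refine measure_mono (iUnion_subset fun U x hx => ?_)
    exact ⟨(β.nonneg_left _ U.2).trans hx.1.le, hx.2.le.trans (β.right_le _ U.2)⟩
  simpa [leb] using h1.trans h2

/-- There are only finitely many blocks longer than a given `h > 0`, so that counting them by
`Set.ncard` is meaningful. -/
theorem finite_longBlocks (β : IntervalPartition) {h : ℝ} (hh : 0 < h) (t : ℝ) :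
    (β.longBlocks h t).Finite := by
  have hfin : ({U : β.blocks | ENNReal.ofReal h ≤ ENNReal.ofReal (leb U.1)}).Finite :=
    ENNReal.finite_const_le_of_tsum_ne_top
      (ne_top_of_le_ne_top ENNReal.ofReal_ne_top β.tsum_leb_le)
      (by simpa using hh)
  refine (hfin.image Subtype.val).subset ?_
  rintro U ⟨hU, h1, -⟩
  refine ⟨⟨U, hU⟩, ?_, rfl⟩
  rw [abs_of_pos (sub_pos.mpr (β.left_lt_right U hU))] at h1
  exact ENNReal.ofReal_le_ofReal h1.le

end IntervalPartition

/-- The set `I_α` of interval partitions with `α`-diversity. -/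
def IAlpha (α : ℝ) : Type := {β : IntervalPartition // β.HasDiversity α}

namespace IAlpha

variable {α : ℝ}

theorem tendsto_scaledCount (β : IAlpha α) {t : ℝ} (ht : t ∈ Icc 0 β.1.mass) :
    Tendsto (β.1.scaledCount α t) (𝓝[>] 0)
      (𝓝 (limUnder (𝓝[>] 0) (β.1.scaledCount α t))) :=
  tendsto_nhds_limUnder (β.2 t ht)

theorem diversity_nonneg (hα : α < 1) (β : IAlpha α) {t : ℝ} (ht : t ∈ Icc 0 β.1.mass) :
    0 ≤ β.1.diversity α t := by
  refine mul_nonneg (Real.Gamma_pos_of_pos (by linarith)).le ?_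
  refine ge_of_tendsto (β.tendsto_scaledCount ht) ?_
  filter_upwards [self_mem_nhdsWithin] with h hh
  exact mul_nonneg (Real.rpow_nonneg (le_of_lt hh) _) (Nat.cast_nonneg _)

theorem diversity_mono (hα : α < 1) (β : IAlpha α) {s t : ℝ} (hs : s ∈ Icc 0 β.1.mass)
    (ht : t ∈ Icc 0 β.1.mass) (hst : s ≤ t) : β.1.diversity α s ≤ β.1.diversity α t := by
  refine mul_le_mul_of_nonneg_left ?_ (Real.Gamma_pos_of_pos (by linarith)).le
  refine le_of_tendsto_of_tendsto (β.tendsto_scaledCount hs) (β.tendsto_scaledCount ht) ?_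
  filter_upwards [self_mem_nhdsWithin] with h hh
  refine mul_le_mul_of_nonneg_left ?_ (Real.rpow_nonneg (le_of_lt hh) _)
  have hsub : β.1.longBlocks h s ⊆ β.1.longBlocks h t :=
    fun U hU => ⟨hU.1, hU.2.1, hU.2.2.trans hst⟩
  exact_mod_cast Set.ncard_le_ncard hsub (β.1.finite_longBlocks hh t)

theorem totalDiversity_nonneg (hα : α < 1) (β : IAlpha α) : 0 ≤ β.1.totalDiversity α :=
  β.diversity_nonneg hα ⟨β.1.mass_nonneg, le_rfl⟩

theorem blockDiversity_mem (hα : α < 1) (β : IAlpha α) {U : ℝ × ℝ} (hU : U ∈ β.1.blocks) :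
    β.1.blockDiversity α U ∈ Icc 0 (β.1.totalDiversity α) := by
  have h1 := β.1.nonneg_left U hU
  have h2 := β.1.left_lt_right U hU
  have h3 := β.1.right_le U hU
  have hm : (U.1 + U.2) / 2 ∈ Icc 0 β.1.mass := ⟨by linarith, by linarith⟩
  exact ⟨β.diversity_nonneg hα hm, β.diversity_mono hα hm ⟨β.1.mass_nonneg, le_rfl⟩ hm.2⟩

end IAlpha

/-! ## The metric `d_α` -/

/-- A correspondence between two interval partitions: a finite (possibly empty) sequence of pairs of
blocks, strictly increasing from left to right in both coordinates. -/
structure Correspondence (β γ : IntervalPartition) where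
  n : ℕ
  U : Fin n → ℝ × ℝ
  V : Fin n → ℝ × ℝ
  U_mem : ∀ j, U j ∈ β.blocks
  V_mem : ∀ j, V j ∈ γ.blocks
  U_strictMono : StrictMono (fun j => (U j).1)
  V_strictMono : StrictMono (fun j => (V j).1)

/-- The `α`-distortion of a correspondence: the maximum of four quantities. (The supremum over an
empty index set is `0`.) -/
def Correspondence.distortion (α : ℝ) {β γ : IntervalPartition} (c : Correspondence β γ) : ℝ :=
  max
    (max
      ((∑ j, |leb (c.U j) - leb (c.V j)|) + β.mass - ∑ j, leb (c.U j))
      ((∑ j, |leb (c.U j) - leb (c.V j)|) + γ.mass - ∑ j, leb (c.V j)))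
    (max
      (⨆ j, |β.blockDiversity α (c.U j) - γ.blockDiversity α (c.V j)|)
      |β.totalDiversity α - γ.totalDiversity α|)

/-- The metric `d_α` on `I_α`: the infimum of the `α`-distortions of all correspondences. -/
def dAlpha (α : ℝ) (β γ : IAlpha α) : ℝ :=
  ⨅ c : Correspondence β.1 γ.1, c.distortion α

/-! ## Compact rooted weighted `ℝ`-trees and the Gromov–Hausdorff–Prokhorov metric -/

/-- `φ` is an isometric embedding of `[0, dist x y]` which goes from `x` to `y`. -/
def IsGeodesic {X : Type} [MetricSpace X] (x y : X) (φ : Icc (0 : ℝ) (dist x y) → X) : Prop :=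
  Isometry φ ∧ φ ⟨0, le_rfl, dist_nonneg⟩ = x ∧ φ ⟨dist x y, dist_nonneg, le_rfl⟩ = y

/-- A metric space is an `ℝ`-tree if any two points are joined by a unique geodesic, and any
injective path between two points has the same range as the geodesic between them. -/
structure IsRTree (X : Type) [MetricSpace X] : Prop where
  existsUnique_geodesic : ∀ x y : X, ∃! φ : Icc (0 : ℝ) (dist x y) → X, IsGeodesic x y φ
  range_arc : ∀ q : unitInterval → X, Continuous q → Function.Injective q →
    ∀ φ : Icc (0 : ℝ) (dist (q 0) (q 1)) → X, IsGeodesic (q 0) (q 1) φ → range q = range φ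

/-- A compact rooted `ℝ`-tree with a finite Borel measure. -/
structure RootedWeightedTree where
  carrier : Type
  [metricSpace : MetricSpace carrier]
  [compactSpace : CompactSpace carrier]
  [measurableSpace : MeasurableSpace carrier]
  [borelSpace : BorelSpace carrier]
  isRTree : IsRTree carrier
  root : carrier
  weight : Measure carrier
  [isFiniteMeasure : IsFiniteMeasure weight]

attribute [instance] RootedWeightedTree.metricSpace RootedWeightedTree.compactSpace
  RootedWeightedTree.measurableSpace RootedWeightedTree.borelSpace
  RootedWeightedTree.isFiniteMeasure

namespace RootedWeightedTree

/-- Two trees are equivalent if there is an isometry between them which preserves roots and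
measures. -/
instance isometrySetoid : Setoid RootedWeightedTree where
  r X Y := ∃ e : X.carrier ≃ᵢ Y.carrier, e X.root = Y.root ∧ X.weight.map e = Y.weight
  iseqv := by
    refine ⟨fun X => ⟨IsometryEquiv.refl _, rfl, Measure.map_id⟩, ?_, ?_⟩
    · rintro X Y ⟨e, h1, h2⟩
      refine ⟨e.symm, by rw [← h1, e.symm_apply_apply], ?_⟩
      rw [← h2, Measure.map_map e.symm.continuous.measurable e.continuous.measurable]
      convert! Measure.map_id
      ext x
      simp
    · rintro X Y Z ⟨e, h1, h2⟩ ⟨f, h3, h4⟩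
      refine ⟨e.trans f, by simp [h1, h3], ?_⟩
      rw [← h4, ← h2, Measure.map_map f.continuous.measurable e.continuous.measurable]
      rfl

/-- The Gromov–Hausdorff–Prokhorov distance: the infimum, over all isometric embeddings of the two
trees into a common metric space, of the maximum of the distance of the roots, the Hausdorff
distance of the images and the Prokhorov distance of the image measures. -/
def ghp (X Y : RootedWeightedTree) : ℝ≥0∞ :=
  ⨅ (Z : Type) (_ : MetricSpace Z) (_ : MeasurableSpace Z) (_ : BorelSpace Z)
    (φ : X.carrier → Z) (ψ : Y.carrier → Z) (_ : Isometry φ) (_ : Isometry ψ),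
    max (edist (φ X.root) (ψ Y.root))
      (max (Metric.hausdorffEDist (range φ) (range ψ))
        (levyProkhorovEDist (X.weight.map φ) (Y.weight.map ψ)))

theorem ghp_le_of_equiv {X X' Y Y' : RootedWeightedTree} (hX : X ≈ X') (hY : Y ≈ Y') :
    ghp X Y ≤ ghp X' Y' := by
  obtain ⟨e, he1, he2⟩ := hX
  obtain ⟨f, hf1, hf2⟩ := hY
  refine le_iInf fun Z => le_iInf fun iZ => le_iInf fun mZ => le_iInf fun bZ => le_iInf fun φ =>
    le_iInf fun ψ => le_iInf fun hφ => le_iInf fun hψ => ?_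
  refine iInf_le_of_le Z <| iInf_le_of_le iZ <| iInf_le_of_le mZ <| iInf_le_of_le bZ ?_
  refine iInf_le_of_le (fun x => φ (e x)) ?_
  refine iInf_le_of_le (fun y => ψ (f y)) ?_
  refine iInf_le_of_le (hφ.comp e.isometry) <| iInf_le_of_le (hψ.comp f.isometry) (le_of_eq ?_)
  change max (edist (φ (e X.root)) (ψ (f Y.root)))
    (max (Metric.hausdorffEDist (range (φ ∘ e)) (range (ψ ∘ f)))
      (levyProkhorovEDist (X.weight.map (φ ∘ e)) (Y.weight.map (ψ ∘ f)))) = _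
  rw [← Measure.map_map hφ.continuous.measurable e.continuous.measurable,
    ← Measure.map_map hψ.continuous.measurable f.continuous.measurable, he2, hf2,
    e.surjective.range_comp, f.surjective.range_comp]
  rw [he1, hf1]

end RootedWeightedTree

/-- The space of (root- and measure-preserving) isometry classes of compact rooted weighted
`ℝ`-trees. -/
def TreeSpace : Type 1 := Quotient RootedWeightedTree.isometrySetoid

/-- The Gromov–Hausdorff–Prokhorov metric on isometry classes. -/
def dGHP : TreeSpace → TreeSpace → ℝ≥0∞ :=
  Quotient.lift₂ RootedWeightedTree.ghp fun _ _ _ _ h1 h2 =>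
    le_antisymm (RootedWeightedTree.ghp_le_of_equiv h1 h2)
      (RootedWeightedTree.ghp_le_of_equiv (Setoid.symm h1) (Setoid.symm h2))

/-! ## The tree of an interval partition -/

theorem geodesic_Icc_apply {D : ℝ} {x y : Icc (0 : ℝ) D}
    {φ : Icc (0 : ℝ) (dist x y) → Icc (0 : ℝ) D} (h : IsGeodesic x y φ)
    (s : Icc (0 : ℝ) (dist x y)) :
    (φ s : ℝ) = if (x : ℝ) ≤ y then (x : ℝ) + s else (x : ℝ) - s := by
  obtain ⟨h1, h2, h3⟩ := h
  have e1 := h1.dist_eq s ⟨0, le_rfl, dist_nonneg⟩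
  have e2 := h1.dist_eq s ⟨dist x y, dist_nonneg, le_rfl⟩
  rw [h2] at e1
  rw [h3] at e2
  have s0 := s.2.1
  have s1 := s.2.2
  simp only [Subtype.dist_eq, Real.dist_eq, sub_zero] at e1 e2 s1
  rw [abs_of_nonneg s0] at e1
  rw [abs_sub_comm (s : ℝ), abs_of_nonneg (sub_nonneg.mpr s1)] at e2
  split_ifs with hxy
  · have ha := abs_of_nonpos (by linarith : (x : ℝ) - y ≤ 0)
    rcases abs_cases ((φ s : ℝ) - x) with h | h <;> rcases abs_cases ((φ s : ℝ) - y) with h' | h' <;>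
      linarith
  · have ha := abs_of_nonneg (by linarith : 0 ≤ (x : ℝ) - y)
    rcases abs_cases ((φ s : ℝ) - x) with h | h <;> rcases abs_cases ((φ s : ℝ) - y) with h' | h' <;>
      linarith

theorem range_geodesic_Icc {D : ℝ} {x y : Icc (0 : ℝ) D}
    {φ : Icc (0 : ℝ) (dist x y) → Icc (0 : ℝ) D} (h : IsGeodesic x y φ) :
    range φ = {z : Icc (0 : ℝ) D | min (x : ℝ) y ≤ z ∧ (z : ℝ) ≤ max (x : ℝ) y} := by
  ext z
  constructor
  · rintro ⟨s, rfl⟩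
    have e := geodesic_Icc_apply h s
    have s0 := s.2.1
    have s1 := s.2.2
    simp only [Subtype.dist_eq, Real.dist_eq] at s1
    change min (x : ℝ) y ≤ φ s ∧ (φ s : ℝ) ≤ max (x : ℝ) y
    rw [e]
    split_ifs with hxy
    · have ha := abs_of_nonpos (by linarith : (x : ℝ) - y ≤ 0)
      rw [min_eq_left hxy, max_eq_right hxy]
      constructor <;> linarith
    · push Not at hxy
      have ha := abs_of_nonneg (by linarith : 0 ≤ (x : ℝ) - y)
      rw [min_eq_right hxy.le, max_eq_left hxy.le]
      constructor <;> linarith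
  · rintro ⟨hz1, hz2⟩
    by_cases hxy : (x : ℝ) ≤ y
    · rw [min_eq_left hxy] at hz1
      rw [max_eq_right hxy] at hz2
      have hs : (z : ℝ) - x ∈ Icc (0 : ℝ) (dist x y) := by
        rw [Subtype.dist_eq, Real.dist_eq, abs_of_nonpos (by linarith)]
        constructor <;> linarith
      refine ⟨⟨_, hs⟩, Subtype.ext ?_⟩
      rw [geodesic_Icc_apply h, if_pos hxy]
      ring
    · have hyx := (not_le.mp hxy).le
      rw [min_eq_right hyx] at hz1
      rw [max_eq_left hyx] at hz2
      have hs : (x : ℝ) - z ∈ Icc (0 : ℝ) (dist x y) := by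
        rw [Subtype.dist_eq, Real.dist_eq, abs_of_nonneg (by linarith)]
        constructor <;> linarith
      refine ⟨⟨_, hs⟩, Subtype.ext ?_⟩
      rw [geodesic_Icc_apply h, if_neg hxy]
      simp

theorem exists_geodesic_Icc {D : ℝ} (x y : Icc (0 : ℝ) D) :
    ∃ φ : Icc (0 : ℝ) (dist x y) → Icc (0 : ℝ) D, IsGeodesic x y φ := by
  have hx := x.2
  have hy := y.2
  have hd : dist x y = |(x : ℝ) - y| := by rw [Subtype.dist_eq, Real.dist_eq]
  by_cases hxy : (x : ℝ) ≤ y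
  · rw [abs_of_nonpos (by linarith)] at hd
    refine ⟨fun s => ⟨x + s, ?_, ?_⟩, ?_, ?_, ?_⟩
    · linarith [hx.1, s.2.1]
    · linarith [hy.2, s.2.2]
    · exact Isometry.of_dist_eq fun s t => by simp [Subtype.dist_eq]
    · exact Subtype.ext (by simp)
    · refine Subtype.ext ?_
      simp only [hd]
      ring
  · rw [abs_of_nonneg (by linarith)] at hd
    refine ⟨fun s => ⟨x - s, ?_, ?_⟩, ?_, ?_, ?_⟩
    · linarith [hy.1, s.2.2]
    · linarith [hx.2, s.2.1]
    · refine Isometry.of_dist_eq fun s t => ?_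
      change |((x : ℝ) - s) - (x - t)| = |(s : ℝ) - t|
      rw [abs_sub_comm (s : ℝ)]
      congr 1
      ring
    · exact Subtype.ext (by simp)
    · refine Subtype.ext ?_
      simp only [hd]
      ring

/-- A compact interval is an `ℝ`-tree. -/
theorem isRTree_Icc (D : ℝ) : IsRTree (Icc (0 : ℝ) D) := by
  refine ⟨fun x y => ?_, fun q hq hinj φ hφ => ?_⟩
  · obtain ⟨φ, hφ⟩ := exists_geodesic_Icc x y
    refine ⟨φ, hφ, fun ψ hψ => funext fun s => Subtype.ext ?_⟩
    rw [geodesic_Icc_apply hφ, geodesic_Icc_apply hψ]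
  · rw [range_geodesic_Icc hφ]
    have hc : Continuous fun t => (q t : ℝ) := continuous_subtype_val.comp hq
    have hi : Function.Injective fun t => (q t : ℝ) := Subtype.val_injective.comp hinj
    have hmono : ∀ t, min (q 0 : ℝ) (q 1) ≤ q t ∧ (q t : ℝ) ≤ max (q 0 : ℝ) (q 1) := by
      intro t
      have t0 : 0 ≤ t := unitInterval.nonneg'
      have t1 : t ≤ 1 := unitInterval.le_one'
      rcases hc.strictMono_of_inj hi with h | h
      · exact ⟨(min_le_left _ _).trans (h.monotone t0), (h.monotone t1).trans (le_max_right _ _)⟩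
      · exact ⟨(min_le_right _ _).trans (h.antitone t1), (h.antitone t0).trans (le_max_left _ _)⟩
    ext z
    constructor
    · rintro ⟨t, rfl⟩
      exact hmono t
    · rintro ⟨hz1, hz2⟩
      have hr := (isPreconnected_range hc).ordConnected.uIcc_subset (mem_range_self 0)
        (mem_range_self 1)
      obtain ⟨t, ht⟩ := hr (show (z : ℝ) ∈ uIcc (q 0 : ℝ) (q 1) from ⟨hz1, hz2⟩)
      exact ⟨t, Subtype.ext ht⟩

namespace IAlpha

variable {α : ℝ}

/-- The measure `∑_{U ∈ β} Leb(U) δ_{D_β(U)}` on `[0, D_β(∞)]`. -/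
def weight (hα : α < 1) (β : IAlpha α) : Measure (Icc (0 : ℝ) (β.1.totalDiversity α)) :=
  Measure.sum fun U : β.1.blocks =>
    ENNReal.ofReal (leb U.1) •
      Measure.dirac ⟨β.1.blockDiversity α U.1, β.blockDiversity_mem hα U.2⟩

theorem isFiniteMeasure_weight (hα : α < 1) (β : IAlpha α) : IsFiniteMeasure (β.weight hα) := by
  refine ⟨?_⟩
  rw [weight, Measure.sum_apply _ MeasurableSet.univ]
  simpa using β.1.tsum_leb_le.trans_lt ENNReal.ofReal_lt_top

/-- The single-branch tree `([0, D_β(∞)], d, M(β))`, rooted at `0`, where `d` is the Euclidean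
metric. -/
def branch (hα : α < 1) (β : IAlpha α) : RootedWeightedTree where
  carrier := Icc (0 : ℝ) (β.1.totalDiversity α)
  isRTree := isRTree_Icc _
  root := ⟨0, le_rfl, β.totalDiversity_nonneg hα⟩
  weight := β.weight hα
  isFiniteMeasure := β.isFiniteMeasure_weight hα

/-- The map `T` from `I_α` to the space of compact rooted weighted `ℝ`-trees. -/
def tree (hα : α < 1) (β : IAlpha α) : TreeSpace :=
  Quotient.mk RootedWeightedTree.isometrySetoid (β.branch hα)

end IAlpha

end

/-! The map is in fact 1-Lipschitz: every correspondence of distortion less than `r` bounds the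
Gromov–Hausdorff–Prokhorov distance by `r` (`ghp_branch_le_of_distortion_lt`). Both trees are
intervals starting at `0`, so the inclusions into `ℝ` serve as the common embedding. The roots then
coincide, and the Hausdorff distance is controlled by the difference of the total diversities
(`hausdorffEDist_Icc_zero_le`).

For the Prokhorov distance, the atom of a matched block `U j` is moved to that of `V j`. It travels
less than `r` by the bound on the block diversities; the mass lost is at most the sum of the length
differences plus the unmatched mass, which is the first or second quantity in the distortion
(`tsum_indicator_le_tsum_indicator_thickening`). -/

/-- The atoms of two families, paired up finitely: the mass of the first family located in `B` is
at most the mass of the second family located near `B`, up to the mass which is not matched. -/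
theorem tsum_indicator_le_tsum_indicator_thickening {ι κ : Type*} {n : ℕ} {f : ι → ℝ} {g : κ → ℝ}
    {p : ι → ℝ} {q : κ → ℝ} {U : Fin n → ι} {V : Fin n → κ} {m r : ℝ}
    (hU : Function.Injective U) (hV : Function.Injective V) (hf : ∀ i, 0 ≤ f i) (hg : ∀ k, 0 ≤ g k)
    (hm : 0 ≤ m) (hfm : ∑' i, ENNReal.ofReal (f i) ≤ ENNReal.ofReal m)
    (hr : (∑ j, |f (U j) - g (V j)|) + m - ∑ j, f (U j) ≤ r)
    (hpq : ∀ j, |p (U j) - q (V j)| < r) (B : Set ℝ) :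
    ∑' i, B.indicator (fun _ => ENNReal.ofReal (f i)) (p i) ≤
      ∑' k, (Metric.thickening r B).indicator (fun _ => ENNReal.ofReal (g k)) (q k) +
        ENNReal.ofReal r := by
  set s : Finset ι := Finset.univ.map ⟨U, hU⟩ with hs
  have hsum : ∀ F : ι → ℝ≥0∞, ∑ i ∈ s, F i = ∑ j, F (U j) := fun F => by simp [hs]
  have hsplit : ∀ F : ι → ℝ≥0∞, ∑' i, F i = ∑ j, F (U j) + ∑' i : ((s : Set ι)ᶜ : Set ι), F i := by
    intro F
    rw [← hsum, ENNReal.sum_add_tsum_compl]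
  -- The unmatched mass is what remains of `m` after the matched terms; an upper bound `m` on the
  -- total suffices.
  have hcompl : ∑' i : ((s : Set ι)ᶜ : Set ι), ENNReal.ofReal (f i) ≤
      ENNReal.ofReal (m - ∑ j, f (U j)) := by
    rw [hsplit, ← ENNReal.ofReal_sum_of_nonneg fun j _ => hf _] at hfm
    rw [ENNReal.ofReal_sub _ (Finset.sum_nonneg fun j _ => hf _)]
    exact ENNReal.le_sub_of_add_le_left ENNReal.ofReal_ne_top hfm
  -- `ENNReal.ofReal` truncates negative numbers, so the two error terms can be merged at the end
  -- only once `m - ∑ j, f (U j)` is known to be nonnegative.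
  have hle : ∑ j, f (U j) ≤ m := by
    rw [← ENNReal.ofReal_le_ofReal_iff hm, ENNReal.ofReal_sum_of_nonneg fun j _ => hf _,
      ← hsum fun i => ENNReal.ofReal (f i)]
    exact (ENNReal.sum_le_tsum s).trans hfm
  have hmatched : ∑ j, B.indicator (fun _ => ENNReal.ofReal (f (U j))) (p (U j)) ≤
      ∑' k, (Metric.thickening r B).indicator (fun _ => ENNReal.ofReal (g k)) (q k) +
        ENNReal.ofReal (∑ j, |f (U j) - g (V j)|) := by
    calc _ ≤ ∑ j, ((Metric.thickening r B).indicator (fun _ => ENNReal.ofReal (g (V j))) (q (V j))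
          + ENNReal.ofReal |f (U j) - g (V j)|) := by
            refine Finset.sum_le_sum fun j _ => ?_
            by_cases hB : p (U j) ∈ B
            -- The thickening is open, hence the strict inequality in `hpq`.
            · have hT : q (V j) ∈ Metric.thickening r B := by
                refine Metric.mem_thickening_iff.mpr ⟨_, hB, ?_⟩
                rw [dist_comm, Real.dist_eq]
                exact hpq j
              rw [indicator_of_mem hB, indicator_of_mem hT,
                ← ENNReal.ofReal_add (hg _) (abs_nonneg _)]
              exact ENNReal.ofReal_le_ofReal (by linarith [le_abs_self (f (U j) - g (V j))])
            · rw [indicator_of_notMem hB]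
              exact zero_le
      _ ≤ _ := by
        rw [Finset.sum_add_distrib, ENNReal.ofReal_sum_of_nonneg fun j _ => abs_nonneg _]
        gcongr
        -- Injectivity of `V` ensures that no atom of the second family is counted twice.
        calc _ = ∑ k ∈ Finset.univ.map ⟨V, hV⟩,
              (Metric.thickening r B).indicator (fun _ => ENNReal.ofReal (g k)) (q k) := by simp
          _ ≤ _ := ENNReal.sum_le_tsum _
  calc _ = ∑ j, B.indicator (fun _ => ENNReal.ofReal (f (U j))) (p (U j)) +
        ∑' i : ((s : Set ι)ᶜ : Set ι), B.indicator (fun _ => ENNReal.ofReal (f i)) (p i) :=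
        hsplit _
    _ ≤ (∑' k, (Metric.thickening r B).indicator (fun _ => ENNReal.ofReal (g k)) (q k) +
        ENNReal.ofReal (∑ j, |f (U j) - g (V j)|)) + ENNReal.ofReal (m - ∑ j, f (U j)) := by
        refine add_le_add hmatched (le_trans ?_ hcompl)
        exact ENNReal.tsum_le_tsum fun i => indicator_apply_le' (fun _ => le_rfl) fun _ => zero_le
    _ ≤ _ := by
        rw [add_assoc, ← ENNReal.ofReal_add (Finset.sum_nonneg fun j _ => abs_nonneg _)
          (sub_nonneg.mpr hle)]
        gcongr
        linarith

/-- Truncating a point of one interval at the right endpoint of the other moves it by at most the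
difference of the lengths. -/
theorem hausdorffEDist_Icc_zero_le {a b r : ℝ} (ha : 0 ≤ a) (hb : 0 ≤ b) (h : |a - b| ≤ r) :
    Metric.hausdorffEDist (Icc 0 a) (Icc 0 b) ≤ ENNReal.ofReal r := by
  have key : ∀ {c d : ℝ}, 0 ≤ d → |c - d| ≤ r → ∀ x ∈ Icc 0 c, ∃ y ∈ Icc 0 d,
      edist x y ≤ ENNReal.ofReal r := by
    intro c d hd hcd x hx
    refine ⟨min x d, ⟨le_min hx.1 hd, min_le_right _ _⟩, ?_⟩
    rw [edist_dist, Real.dist_eq]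
    refine ENNReal.ofReal_le_ofReal ?_
    have := abs_le.mp hcd
    rcases le_total x d with hxd | hxd
    · rw [min_eq_left hxd, sub_self, abs_zero]
      exact (abs_nonneg _).trans hcd
    · rw [min_eq_right hxd, abs_of_nonneg (sub_nonneg.mpr hxd)]
      linarith [hx.2]
  exact Metric.hausdorffEDist_le_of_mem_edist (key hb h) (key ha (by rwa [abs_sub_comm]))

/-! ### Distortion bounds the Gromov–Hausdorff–Prokhorov distance -/

namespace IAlpha

variable {α : ℝ}

theorem map_val_weight_apply (hα : α < 1) (β : IAlpha α) {B : Set ℝ} (hB : MeasurableSet B) :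
    (β.weight hα).map Subtype.val B = ∑' U : β.1.blocks,
      B.indicator (fun _ => ENNReal.ofReal (leb U.1)) (β.1.blockDiversity α U.1) := by
  have hB' := measurable_subtype_coe (p := (· ∈ Icc 0 (β.1.totalDiversity α))) hB
  rw [Measure.map_apply measurable_subtype_coe hB, weight, Measure.sum_apply _ hB']
  refine tsum_congr fun U => ?_
  rw [Measure.smul_apply, Measure.dirac_apply' _ hB']
  by_cases h : β.1.blockDiversity α U.1 ∈ B <;> simp [h]

theorem leb_nonneg (β : IAlpha α) (U : β.1.blocks) : 0 ≤ leb U.1 :=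
  sub_nonneg.mpr (β.1.left_lt_right _ U.2).le

theorem ghp_branch_le_of_distortion_lt (hα : α < 1) {β γ : IAlpha α}
    (c : Correspondence β.1 γ.1) {r : ℝ} (hr : c.distortion α < r) :
    RootedWeightedTree.ghp (β.branch hα) (γ.branch hα) ≤ ENNReal.ofReal r := by
  simp only [Correspondence.distortion, max_lt_iff] at hr
  obtain ⟨⟨hβ, hγ⟩, hsup, htot⟩ := hr
  have hr0 : 0 ≤ r := (abs_nonneg _).trans htot.le
  -- A real supremum dominates its terms only when the family is bounded; here the index set is
  -- finite.
  have hdiv : ∀ j, |β.1.blockDiversity α (c.U j) - γ.1.blockDiversity α (c.V j)| < r := fun j =>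
    (le_ciSup (f := fun j => |β.1.blockDiversity α (c.U j) - γ.1.blockDiversity α (c.V j)|)
      (finite_range _).bddAbove j).trans_lt hsup
  let U : Fin c.n → β.1.blocks := fun j => ⟨c.U j, c.U_mem j⟩
  let V : Fin c.n → γ.1.blocks := fun j => ⟨c.V j, c.V_mem j⟩
  -- The left-to-right order of the blocks matters only through this injectivity.
  have hU : Function.Injective U := fun i j h =>
    c.U_strictMono.injective (congrArg (fun W : β.1.blocks => W.1.1) h)
  have hV : Function.Injective V := fun i j h =>
    c.V_strictMono.injective (congrArg (fun W : γ.1.blocks => W.1.1) h)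
  refine iInf_le_of_le ℝ <| iInf_le_of_le inferInstance <| iInf_le_of_le inferInstance <|
    iInf_le_of_le inferInstance <| iInf_le_of_le Subtype.val <| iInf_le_of_le Subtype.val <|
    iInf_le_of_le isometry_subtype_coe <| iInf_le_of_le isometry_subtype_coe ?_
  refine max_le ?_ (max_le ?_ ?_)
  · exact (edist_self (0 : ℝ)).trans_le zero_le
  · change Metric.hausdorffEDist (range (Subtype.val : Icc 0 (β.1.totalDiversity α) → ℝ))
      (range (Subtype.val : Icc 0 (γ.1.totalDiversity α) → ℝ)) ≤ _
    rw [Subtype.range_coe, Subtype.range_coe]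
    exact hausdorffEDist_Icc_zero_le (β.totalDiversity_nonneg hα) (γ.totalDiversity_nonneg hα)
      htot.le
  · change levyProkhorovEDist ((β.weight hα).map Subtype.val) ((γ.weight hα).map Subtype.val) ≤ _
    -- The Prokhorov distance is an infimum of admissible radii, so it suffices that `r` is
    -- admissible, in both directions.
    refine sInf_le fun B hB => ?_
    have hT : MeasurableSet (Metric.thickening r B) := Metric.isOpen_thickening.measurableSet
    rw [ENNReal.toReal_ofReal hr0, map_val_weight_apply hα β hB, map_val_weight_apply hα γ hB,
      map_val_weight_apply hα β hT, map_val_weight_apply hα γ hT]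
    constructor
    · exact tsum_indicator_le_tsum_indicator_thickening
        (p := fun W : β.1.blocks => β.1.blockDiversity α W.1)
        (q := fun W : γ.1.blocks => γ.1.blockDiversity α W.1) hU hV β.leb_nonneg γ.leb_nonneg
        β.1.mass_nonneg β.1.tsum_leb_le hβ.le hdiv B
    · refine tsum_indicator_le_tsum_indicator_thickening
        (p := fun W : γ.1.blocks => γ.1.blockDiversity α W.1)
        (q := fun W : β.1.blocks => β.1.blockDiversity α W.1) hV hU γ.leb_nonneg β.leb_nonneg
        γ.1.mass_nonneg γ.1.tsum_leb_le ?_ (fun j => ?_) B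
      · simp only [abs_sub_comm (leb (V _).1)]
        exact hγ.le
      · rw [abs_sub_comm]
        exact hdiv j

end IAlpha

/-- The empty correspondence is always allowed, so `dAlpha` is never an infimum over the empty set,
and a strict upper bound on it is attained by some correspondence. -/
instance Correspondence.instNonempty (β γ : IntervalPartition) : Nonempty (Correspondence β γ) :=
  ⟨⟨0, Fin.elim0, Fin.elim0, fun j => j.elim0, fun j => j.elim0, fun j => j.elim0,
    fun j => j.elim0⟩⟩

theorem corollary4 (α : ℝ) (hα0 : 0 < α) (hα1 : α < 1) :
    ∀ β : IAlpha α, ∀ ε : ℝ, 0 < ε → ∃ δ : ℝ, 0 < δ ∧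
      ∀ γ : IAlpha α, dAlpha α β γ < δ →
        dGHP (β.tree hα1) (γ.tree hα1) < ENNReal.ofReal ε := by
  intro β ε hε
  -- Halving turns the non-strict bound by `δ` into a strict bound by `ε`.
  refine ⟨ε / 2, half_pos hε, fun γ h => ?_⟩
  obtain ⟨c, hc⟩ := exists_lt_of_ciInf_lt h
  exact (IAlpha.ghp_branch_le_of_distortion_lt hα1 c hc).trans_lt
    ((ENNReal.ofReal_lt_ofReal_iff hε).mpr (half_lt_self hε))
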